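/- Let $\pi$ be a probability distribution on a measurable state space $\mathcal X$ of vectors $x=(x_1,\dots,x_N)$ (a measurable subset of a product of $N$ measurable spaces, with $\pi(\mathcal X)=1$). For each $i$ fix a full conditional distribution $\pi(x_i\mid x_{-i})$ such that the Gibbs step $P_i$ for coordinate $i$ (redraw $x_i$ from $\pi(x_i\mid x_{-i})$ and keep $x_{-i}$) is a Markov kernel on $\mathcal X$. For $q\in(0,1]^N$ define two samplers. One draw of $\mathrm{RSG}(q)$ selects one coordinate $i$ with probability $q_i/\sum_j q_j$ (that is, $q_i$ if the entries of $q$ sum to one) and applies $P_i$. One iteration of $\mathrm{MRSG}(q)$ draws independent $b_i\sim\mathrm{Bernoulli}(q_i)$, $i=1,\dots,N$, repeating until some $b_i=1$, and applies successively, in increasing order of $i$, the steps $P_i$ with $b_i=1$. A sampler with kernel $P$ is uniformly ergodic if $\sup_{x\in\mathcal X}\|P^n(x,\cdot)-\pi\|_{TV}\to0$. Consider an adaptive run with states $X^{(h)}$ and random selection probabilities $q^{(h)}$, $h\ge0$, started from fixed $X^{(0)}=x^{(0)}\in\mathcal X$ and $q^{(0)}$, where the selection probabilities may depend on the past in any way,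 and let $\pi^{(h)}(x^{(0)},q^{(0)})$ be the distribution of $X^{(h)}$. Let $\epsilon>0$ and $q^{(h)}\in[\epsilon,1]^N$ for all $h$, and assume a) $|q^{(h)}-q^{(h-1)}|\to0$ in probability as $h\to\infty$. Then $\|\pi^{(h)}(x^{(0)},q^{(0)})-\pi\|_{TV}\to0$ as $h\to\infty$ in each of the following cases. (i) (Adaptive random scan.) For some $V\ge1$, given the past, iteration $h$ consists of $V$ draws of $\mathrm{RSG}(q^{(h)})$, where $q^{(h)}$ is determined by the history up to iteration $h-1$; and b) there is $q\in[\epsilon,1]^N$ such that $\mathrm{RSG}(q)$ is uniformly ergodic. (ii) (Adaptive multiple random scan.) Given the past, iteration $h$ is one iteration of $\mathrm{MRSG}(q^{(h-1)})$, where $q^{(h-1)}$ is determined by the history up to iteration $h-1$. Call coordinate $i$ *bounded away from one* if for some $\delta>0$ and some $h_0$, almost surely $q_i^{(h)}\le1-\delta$ for all $h\ge h_0$. Moreover, one of the following holds: b') there is $q\in[\epsilon,1]^N$ such that $\mathrm{MRSG}(q)$ is uniformly ergodic, and every $i$ with $q_i<1$ is bounded away from one (no condition if $q=(1,\dots,1)$,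 when $\mathrm{MRSG}(q)$ is the systematic scan); or b'') there is $q\in[\epsilon,1]^N$ such that $\mathrm{RSG}(q)$ is uniformly ergodic, and every $i$ is bounded away from one. -/

import Mathlib

open MeasureTheory ProbabilityTheory Filter Topology
open scoped ENNReal

namespace RandomScan

/-- Total variation distance: the supremum over all measurable events of `|μ A - ν A|`. -/
noncomputable def tv {α : Type*} [MeasurableSpace α] (μ ν : Measure α) : ℝ≥0∞ :=
  ⨆ (A : Set α) (_ : MeasurableSet A), ENNReal.ofReal |μ.real A - ν.real A|

/-- The Markov chain with transition kernel `K` on the state space `S` is uniformly ergodic with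
limit `π`: `sup_{x ∈ S} ‖Kⁿ(x, ·) - π‖_TV → 0`. -/
def UniformlyErgodicOn {α : Type*} [MeasurableSpace α] (S : Set α) (K : Kernel α α)
    (π : Measure α) : Prop :=
  Tendsto (fun n : ℕ => ⨆ x ∈ S, tv ((K ^ n) x) π) atTop (𝓝 0)

/-- The finite mixture of kernels `x ↦ ∑ i, w i • K i x`. -/
noncomputable def mixture {α ι : Type*} [MeasurableSpace α] [Fintype ι] (w : ι → ℝ)
    (K : ι → Kernel α α) : Kernel α α where
  toFun x := ∑ i, ENNReal.ofReal (w i) • K i x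
  measurable' := by
    refine Measure.measurable_of_measurable_coe _ fun s hs => ?_
    simp only [Measure.coe_finsetSum, Finset.sum_apply, Measure.coe_smul, Pi.smul_apply,
      smul_eq_mul]
    exact Finset.measurable_sum _ fun i _ => ((K i).measurable_coe hs).const_mul _

section

variable {N : ℕ} {E : Fin N → Type*} [∀ i, MeasurableSpace (E i)]

/-- The coordinates of `x` other than the `i`-th one, `x_{-i}`. -/
def others (i : Fin N) (x : ∀ j, E j) : ∀ j : {j : Fin N // j ≠ i}, E j.1 := fun j => x j.1

theorem measurable_others (i : Fin N) : Measurable (others (E := E) i) :=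
  measurable_pi_lambda _ fun j => measurable_pi_apply j.1

/-- `κ` is a version of the full conditional distribution `π(x_i | x_{-i})`. -/
def IsFullConditional (π : Measure (∀ j, E j)) (i : Fin N)
    (κ : Kernel (∀ j : {j : Fin N // j ≠ i}, E j.1) (E i)) : Prop :=
  HasCondDistrib (fun x : ∀ j, E j => x i) (others i) κ π

/-- The Gibbs step for coordinate `i`: keep `x_{-i}` and redraw `x_i` from `κ (x_{-i})`. -/
noncomputable def gibbsStep (i : Fin N)
    (κ : Kernel (∀ j : {j : Fin N // j ≠ i}, E j.1) (E i)) :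
    Kernel (∀ j, E j) (∀ j, E j) :=
  (Kernel.id ×ₖ κ.comap (others i) (measurable_others i)).map
    fun p => Function.update p.1 i p.2

/-- The sampler `RSG(q)`, one draw: a coordinate `i` is selected with probability `q i / ∑ j, q j`
(which is `q i` when the entries of `q` sum to one) and a Gibbs step is made for it. -/
noncomputable def rsg (κ : ∀ i : Fin N, Kernel (∀ j : {j : Fin N // j ≠ i}, E j.1) (E i))
    (q : Fin N → ℝ) : Kernel (∀ j, E j) (∀ j, E j) :=
  mixture (fun i => q i / ∑ j, q j) fun i => gibbsStep i (κ i)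

/-- Gibbs steps made one after the other for the coordinates in the list, the head first. -/
noncomputable def scan (κ : ∀ i : Fin N, Kernel (∀ j : {j : Fin N // j ≠ i}, E j.1) (E i)) :
    List (Fin N) → Kernel (∀ j, E j) (∀ j, E j)
  | [] => Kernel.id
  | i :: l => scan κ l ∘ₖ gibbsStep i (κ i)

/-- The probability that the random set `{i | b i = 1}` equals `S`, where the `b i` are
independent Bernoulli variables with parameters `q i`, redrawn until the set is nonempty. -/
noncomputable def selectProb (q : Fin N → ℝ) (S : Finset (Fin N)) : ℝ :=
  if S.Nonempty then ((∏ i ∈ S, q i) * ∏ i ∈ Sᶜ, (1 - q i)) / (1 - ∏ i, (1 - q i)) else 0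

/-- The sampler `MRSG(q)`, one iteration: a nonempty random set of coordinates is selected, and
successive Gibbs steps are made for its elements, in increasing order. -/
noncomputable def mrsg (κ : ∀ i : Fin N, Kernel (∀ j : {j : Fin N // j ≠ i}, E j.1) (E i))
    (q : Fin N → ℝ) : Kernel (∀ j, E j) (∀ j, E j) :=
  mixture (selectProb q) fun S => scan κ (S.sort (· ≤ ·))

end

/-- `X` is an adaptive chain for the family of kernels `K`: with respect to the history `ℱ`, the
selection probabilities `r h` used for the transition from `X h` to `X (h + 1)` are known at time
`h`, and given the history up to time `h` the conditional law of `X (h + 1)` is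
`K (r h) (X h, ·)`. -/
structure IsAdaptiveChain {N : ℕ} {α Ω : Type*} [MeasurableSpace α] {mΩ : MeasurableSpace Ω}
    (P : Measure Ω) (ℱ : Filtration ℕ mΩ) (K : (Fin N → ℝ) → Kernel α α)
    (X : ℕ → Ω → α) (r : ℕ → Ω → Fin N → ℝ) : Prop where
  measurable_state : ∀ h, Measurable[ℱ h] (X h)
  measurable_prob : ∀ h, Measurable[ℱ h] (r h)
  transition : ∀ h, ∀ A : Set α, MeasurableSet A →
    P[(X (h + 1) ⁻¹' A).indicator (fun _ => (1 : ℝ)) | ℱ h]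
      =ᵐ[P] fun ω => (K (r h ω) (X h ω)).real A

end RandomScan

/-!
The argument is a frozen-parameter comparison. Let `K p` be the transition kernel of one iteration
with selection probabilities `p`; with `V` draws per iteration it is the `V`-th power of the kernel
of one draw, and the first step below is applied to the latter.

*Simultaneous uniform ergodicity.* For `p` in the admissible compact box, `K p` is a mixture of
compositions of Gibbs steps whose weights are bounded below wherever those of the given uniformly
ergodic kernel `L` are positive, so `K p ≥ c L` with `c` independent of `p`
(`le_div_sum`, `le_selectProb`, `rsg_minorization`). This is where coordinates must be bounded away
from one: a set omitting coordinate `i` has a weight that vanishes as `p i → 1`. It follows that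
`(K p)ⁿ ≥ cⁿ Lⁿ`, and for suitable `n` every event with `π`-probability at least `1/2` has
`(K p)ⁿ`-probability at least `η > 0` from every state in `S`. Such a kernel shrinks the range on
`S` of each bounded function by the factor `1 - η / 2` (`Compatible.exists_smaller_range`), and all
the `K p` preserve `π`; hence `(K p)ⁿ → π` uniformly in `p` and in the starting point
(`exists_pow_close_of_minorization`).

*Diminishing adaptation.* Write `r h` for the parameter used at time `h` and
`f_m (p, x) = (K p)ᵐ (x, A)`. Then `P (X (h + n) ∈ A) - E f_n (r h, X h)` telescopes into the `n`
differences `E f_{n-j-1} (r h, X (h + j + 1)) - E f_{n-j} (r h, X (h + j))`. By the Markov property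
given the history, each compares one step of `K (r (h + j))` with one step of `K (r h)`, and these
kernels are close with high probability for large `h`, since the weights are uniformly continuous
on the box. As `f_n` is uniformly close to `π A` for large `n`, so is `P (X (h + n) ∈ A)`
(`tendsto_tv_of_diminishing_adaptation`).
-/

namespace RandomScan

/-! ### Markov kernels with a common stationary law: contraction and minorization -/

section Kernels

variable {α : Type*} [MeasurableSpace α]

theorem pow_succ_eq_comp (K : Kernel α α) (n : ℕ) : K ^ (n + 1) = (K ^ n) ∘ₖ K :=
  pow_succ K n

theorem isMarkovKernel_pow (K : Kernel α α) [IsMarkovKernel K] (n : ℕ) :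
    IsMarkovKernel (K ^ n) := by
  induction n with
  | zero => rw [pow_zero]; exact inferInstanceAs (IsMarkovKernel Kernel.id)
  | succ n ih => rw [pow_succ_eq_comp]; infer_instance

theorem integrable_of_mem_Icc {μ : Measure α} [IsFiniteMeasure μ] {g : α → ℝ} (hg : Measurable g)
    {a b : ℝ} (h : ∀ᵐ x ∂μ, g x ∈ Set.Icc a b) : Integrable g μ :=
  Integrable.of_mem_Icc a b hg.aemeasurable h

theorem measurable_real_apply (K : Kernel α α) {A : Set α} (hA : MeasurableSet A) :
    Measurable fun x => (K x).real A :=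
  (K.measurable_coe hA).ennreal_toReal

theorem real_bind (μ : Measure α) (K : Kernel α α) [IsMarkovKernel K] {A : Set α}
    (hA : MeasurableSet A) : (μ.bind K).real A = ∫ y, (K y).real A ∂μ := by
  simp only [measureReal_def]
  rw [integral_toReal (K.measurable_coe hA).aemeasurable (by simp),
    Measure.bind_apply hA K.aemeasurable]

theorem real_comp_apply (K L : Kernel α α) [IsMarkovKernel L] (x : α) {A : Set α}
    (hA : MeasurableSet A) : ((L ∘ₖ K) x).real A = ∫ y, (L y).real A ∂K x := by
  rw [Kernel.comp_apply, real_bind _ _ hA]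

/-- The properties of the Gibbs steps that pass to every sampler built from them: `K` is a Markov
kernel, `π` is stationary for it, and it does not leave the state space `S`. -/
structure Compatible (S : Set α) (π : Measure α) (K : Kernel α α) : Prop where
  isMarkov : IsMarkovKernel K
  invariant : K.Invariant π
  absorbing : ∀ x ∈ S, K x Sᶜ = 0

theorem Compatible.id (S : Set α) (π : Measure α) (hS : MeasurableSet S) :
    Compatible S π Kernel.id where
  isMarkov := inferInstance
  invariant := by rw [Kernel.Invariant, Measure.id_comp]
  absorbing x hx := by
    rw [Kernel.id_apply, Measure.dirac_apply' _ hS.compl]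
    simpa using hx

theorem absorbing_comp {S : Set α} (hS : MeasurableSet S) {K L : Kernel α α}
    (hL : ∀ x ∈ S, L x Sᶜ = 0) (hK : ∀ x ∈ S, K x Sᶜ = 0) :
    ∀ x ∈ S, (L ∘ₖ K) x Sᶜ = 0 := by
  intro x hx
  rw [Kernel.comp_apply' _ _ _ hS.compl, lintegral_eq_zero_iff (L.measurable_coe hS.compl)]
  have h : ∀ᵐ y ∂K x, y ∈ S := hK x hx
  filter_upwards [h] with y hy using hL y hy

theorem Compatible.comp {S : Set α} {π : Measure α} (hS : MeasurableSet S) {K L : Kernel α α}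
    (hL : Compatible S π L) (hK : Compatible S π K) : Compatible S π (L ∘ₖ K) where
  isMarkov := by
    have := hL.isMarkov
    have := hK.isMarkov
    infer_instance
  invariant := hL.invariant.comp hK.invariant
  absorbing := absorbing_comp hS hL.absorbing hK.absorbing

theorem Compatible.pow {S : Set α} {π : Measure α} (hS : MeasurableSet S) {K : Kernel α α}
    (hK : Compatible S π K) (n : ℕ) : Compatible S π (K ^ n) := by
  induction n with
  | zero => exact pow_zero K ▸ Compatible.id S π hS
  | succ n ih => exact pow_succ_eq_comp K n ▸ ih.comp hS hK

theorem absorbing_pow {S : Set α} (hS : MeasurableSet S) {K : Kernel α α}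
    (hK : ∀ x ∈ S, K x Sᶜ = 0) (n : ℕ) : ∀ x ∈ S, (K ^ n) x Sᶜ = 0 := by
  induction n with
  | zero =>
    intro x hx
    rw [pow_zero]
    change Kernel.id x Sᶜ = 0
    rw [Kernel.id_apply, Measure.dirac_apply' _ hS.compl]
    simpa using hx
  | succ n ih => exact pow_succ_eq_comp K n ▸ absorbing_comp hS ih hK

/-- One step of the contraction: if every event of `π`-probability at least `1/2` has probability
at least `η` after one step from any state in `S`, then averaging over a step shrinks the range of
a function on `S` by the factor `1 - η / 2`. One of the upper and lower halves of the range is hit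
by `π` with probability at least `1/2`; then all the averages move away from the opposite end. -/
theorem Compatible.exists_smaller_range {S : Set α} {π : Measure α} [IsProbabilityMeasure π]
    {K : Kernel α α} (hK : Compatible S π K) {η : ℝ}
    (hη : ∀ x ∈ S, ∀ A, MeasurableSet A → 1 / 2 ≤ π.real A → η ≤ (K x).real A)
    {f : α → ℝ} (hf : Measurable f) {a b : ℝ} (hab : a ≤ b) (hfab : ∀ x ∈ S, f x ∈ Set.Icc a b) :
    ∃ a' b', b' - a' = (1 - η / 2) * (b - a) ∧
      ∀ x ∈ S, ∫ y, f y ∂K x ∈ Set.Icc a' b' := by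
  have := hK.isMarkov
  have hae : ∀ x ∈ S, ∀ᵐ y ∂K x, f y ∈ Set.Icc a b := fun x hx => by
    have h : ∀ᵐ y ∂K x, y ∈ S := hK.absorbing x hx
    filter_upwards [h] with y hy using hfab y hy
  have hint : ∀ x ∈ S, Integrable f (K x) := fun x hx => integrable_of_mem_Icc hf (hae x hx)
  have hlow : ∀ x ∈ S, a ≤ ∫ y, f y ∂K x := fun x hx => by
    simpa using integral_mono_ae (integrable_const a) (hint x hx)
      ((hae x hx).mono fun y hy => hy.1)
  have hupp : ∀ x ∈ S, ∫ y, f y ∂K x ≤ b := fun x hx => by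
    simpa using integral_mono_ae (hint x hx) (integrable_const b)
      ((hae x hx).mono fun y hy => hy.2)
  set T : Set α := {y | (a + b) / 2 ≤ f y} with hT
  have hTm : MeasurableSet T := measurableSet_le measurable_const hf
  have hind : ∀ (A : Set α), MeasurableSet A → ∀ x, ∀ s t : ℝ,
      Integrable (fun y => s + A.indicator (fun _ => t) y) (K x) ∧
      ∫ y, (s + A.indicator (fun _ => t) y) ∂K x = s + t * (K x).real A := fun A hA x s t => by
    have h1 : Integrable (A.indicator fun _ => t) (K x) := (integrable_const t).indicator hA
    refine ⟨(integrable_const s).add h1, ?_⟩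
    rw [integral_add (integrable_const s) h1, integral_indicator_const _ hA]
    simp [mul_comm]
  rcases le_or_gt (1 / 2) (π.real T) with hπ | hπ
  · refine ⟨a + (b - a) / 2 * η, b, by ring, fun x hx => ⟨?_, hupp x hx⟩⟩
    obtain ⟨h1, h2⟩ := hind T hTm x a ((b - a) / 2)
    have h3 := integral_mono_ae h1 (hint x hx) <| by
      filter_upwards [hae x hx] with y hy
      by_cases hyT : y ∈ T
      · simp only [Set.indicator_of_mem hyT]
        have : (a + b) / 2 ≤ f y := hyT
        linarith
      · simpa [Set.indicator_of_notMem hyT] using hy.1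
    rw [h2] at h3
    have := mul_le_mul_of_nonneg_left (hη x hx T hTm hπ) (by linarith : 0 ≤ (b - a) / 2)
    linarith
  · have hπ' : 1 / 2 ≤ π.real Tᶜ := by
      rw [measureReal_compl hTm]
      simp only [probReal_univ]
      linarith
    refine ⟨a, b - (b - a) / 2 * η, by ring, fun x hx => ⟨hlow x hx, ?_⟩⟩
    obtain ⟨h1, h2⟩ := hind Tᶜ hTm.compl x b (-((b - a) / 2))
    have h3 := integral_mono_ae (hint x hx) h1 <| by
      filter_upwards [hae x hx] with y hy
      by_cases hyT : y ∈ Tᶜ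
      · simp only [Set.indicator_of_mem hyT]
        have : f y < (a + b) / 2 := not_le.1 hyT
        linarith
      · simpa [Set.indicator_of_notMem hyT] using hy.2
    rw [h2] at h3
    have := mul_le_mul_of_nonneg_left (hη x hx _ hTm.compl hπ') (by linarith : 0 ≤ (b - a) / 2)
    linarith

theorem Compatible.abs_pow_sub_le {S : Set α} {π : Measure α} [IsProbabilityMeasure π]
    (hS : MeasurableSet S) (hπS : π Sᶜ = 0) {K : Kernel α α} (hK : Compatible S π K) {η : ℝ}
    (hη1 : η ≤ 1)
    (hη : ∀ x ∈ S, ∀ A, MeasurableSet A → 1 / 2 ≤ π.real A → η ≤ (K x).real A)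
    (n : ℕ) {x : α} (hx : x ∈ S) {A : Set α} (hA : MeasurableSet A) :
    |((K ^ n) x).real A - π.real A| ≤ (1 - η / 2) ^ n := by
  have hrange : ∀ n : ℕ, ∃ a b : ℝ, b - a = (1 - η / 2) ^ n ∧
      ∀ x ∈ S, ((K ^ n) x).real A ∈ Set.Icc a b := by
    intro n
    have := (hK.pow hS n).isMarkov
    induction n with
    | zero => exact ⟨0, 1, by simp, fun x _ => ⟨measureReal_nonneg, measureReal_le_one⟩⟩
    | succ n ih =>
      have := (hK.pow hS n).isMarkov
      obtain ⟨a, b, hab, h⟩ := ih this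
      have h0 : 0 ≤ (1 - η / 2) ^ n := pow_nonneg (by linarith) n
      obtain ⟨a', b', hab', h'⟩ := hK.exists_smaller_range hη (measurable_real_apply (K ^ n) hA)
        (by linarith) h
      refine ⟨a', b', by rw [hab', hab]; ring, fun x hx => ?_⟩
      rw [pow_succ_eq_comp, real_comp_apply _ _ _ hA]
      exact h' x hx
  obtain ⟨a, b, hab, h⟩ := hrange n
  have hKn := hK.pow hS n
  have := hKn.isMarkov
  have hae : ∀ᵐ y ∂π, ((K ^ n) y).real A ∈ Set.Icc a b := by
    have hy : ∀ᵐ y ∂π, y ∈ S := hπS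
    filter_upwards [hy] with y hy using h y hy
  have hint := integrable_of_mem_Icc (measurable_real_apply (K ^ n) hA) hae
  have hπA : π.real A = ∫ y, ((K ^ n) y).real A ∂π := by
    rw [← real_bind π _ hA, hKn.invariant.def]
  have h1 : a ≤ π.real A := by
    rw [hπA]
    simpa using integral_mono_ae (integrable_const a) hint (hae.mono fun y hy => hy.1)
  have h2 : π.real A ≤ b := by
    rw [hπA]
    simpa using integral_mono_ae hint (integrable_const b) (hae.mono fun y hy => hy.2)
  have h3 := h x hx
  rw [abs_le]
  constructor <;> linarith [h3.1, h3.2]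

/-- A minorization of one kernel by another passes to their powers. -/
theorem pow_minorization {K L : Kernel α α} {c : ℝ≥0∞}
    (h : ∀ x A, MeasurableSet A → c * L x A ≤ K x A) (n : ℕ) (x : α) {A : Set α}
    (hA : MeasurableSet A) : c ^ n * (L ^ n) x A ≤ (K ^ n) x A := by
  have hle : ∀ x, c • L x ≤ K x := fun x => Measure.le_iff.2 fun A hA => by simpa using h x A hA
  induction n generalizing x with
  | zero => simp
  | succ n ih =>
    rw [pow_succ_eq_comp, pow_succ_eq_comp, Kernel.comp_apply' _ _ _ hA,
      Kernel.comp_apply' _ _ _ hA]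
    calc c ^ (n + 1) * ∫⁻ y, (L ^ n) y A ∂L x
        = ∫⁻ y, c ^ n * (L ^ n) y A ∂(c • L x) := by
          rw [lintegral_smul_measure, lintegral_const_mul _ ((L ^ n).measurable_coe hA), pow_succ]
          simp only [smul_eq_mul]
          ring
      _ ≤ ∫⁻ y, (K ^ n) y A ∂K x := lintegral_mono' (hle x) fun y => ih y

theorem abs_real_sub_le_of_tv_le {μ ν : Measure α} {t : ℝ} (ht : 0 ≤ t)
    (h : tv μ ν ≤ ENNReal.ofReal t) {A : Set α} (hA : MeasurableSet A) :
    |μ.real A - ν.real A| ≤ t := by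
  have h1 : ENNReal.ofReal |μ.real A - ν.real A| ≤ tv μ ν :=
    le_iSup₂ (f := fun (A : Set α) (_ : MeasurableSet A) =>
      ENNReal.ofReal |μ.real A - ν.real A|) A hA
  exact (ENNReal.ofReal_le_ofReal_iff ht).1 (h1.trans h)

/-- Simultaneous uniform ergodicity: kernels that all dominate a fixed multiple of one uniformly
ergodic kernel, and all have `π` as a stationary distribution, converge to `π` uniformly over the
starting point and over the kernel. -/
theorem exists_pow_close_of_minorization {Θ : Type*} {S : Set α} {π : Measure α}
    [IsProbabilityMeasure π] (hS : MeasurableSet S) (hπS : π Sᶜ = 0) {K : Θ → Kernel α α}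
    (hK : ∀ p, Compatible S π (K p)) {L : Kernel α α} (hL : UniformlyErgodicOn S L π)
    {c : ℝ} (hc : 0 < c) (hmin : ∀ p x A, MeasurableSet A → ENNReal.ofReal c * L x A ≤ K p x A)
    {V : ℕ} (hV : 1 ≤ V) {t : ℝ} (ht : 0 < t) :
    ∃ n : ℕ, ∀ p, ∀ x ∈ S, ∀ A, MeasurableSet A →
      |(((K p ^ V) ^ n) x).real A - π.real A| ≤ t := by
  obtain ⟨n, hn⟩ := eventually_atTop.1
    (hL.eventually (ge_mem_nhds (by simp : (0 : ℝ≥0∞) < ENNReal.ofReal (1 / 4))))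
  -- a multiple of `V` steps of `L` is needed, as one iteration of the sampler is `V` steps of `K p`
  have hL4 : ∀ x ∈ S, ∀ A, MeasurableSet A → 1 / 2 ≤ π.real A →
      1 / 4 ≤ ((L ^ (V * n)) x).real A := by
    intro x hx A hA hπA
    have h1 : tv ((L ^ (V * n)) x) π ≤ ENNReal.ofReal (1 / 4) :=
      (le_iSup₂ (f := fun x (_ : x ∈ S) => tv ((L ^ (V * n)) x) π) x hx).trans
        (hn (V * n) (Nat.le_mul_of_pos_left n hV))
    have h2 := (abs_le.1 (abs_real_sub_le_of_tv_le (by norm_num) h1 hA)).1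
    linarith
  set η : ℝ := min 1 (c ^ (V * n) / 4) with hη
  have hη0 : 0 < η := by positivity
  have hstep : ∀ p, ∀ x ∈ S, ∀ A, MeasurableSet A → 1 / 2 ≤ π.real A →
      η ≤ ((K p ^ (V * n)) x).real A := by
    intro p x hx A hA hπA
    have := ((hK p).pow hS (V * n)).isMarkov
    have h1 := ENNReal.toReal_mono (measure_ne_top _ _) (pow_minorization (hmin p) (V * n) x hA)
    rw [ENNReal.toReal_mul, ENNReal.toReal_pow, ENNReal.toReal_ofReal hc.le] at h1
    have h2 := mul_le_mul_of_nonneg_left (hL4 x hx A hA hπA) (pow_pos hc (V * n)).le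
    simp only [measureReal_def] at h2 ⊢
    exact (min_le_right _ _).trans (by linarith)
  obtain ⟨m, hm⟩ := exists_pow_lt_of_lt_one ht (by linarith : 1 - η / 2 < 1)
  refine ⟨n * m, fun p x hx A hA => ?_⟩
  rw [← pow_mul, ← mul_assoc, pow_mul]
  exact (((hK p).pow hS (V * n)).abs_pow_sub_le hS hπS (min_le_left _ _) (hstep p) m hx hA).trans
    hm.le

end Kernels

/-! ### Adaptive chains with diminishing adaptation -/

section Adaptive

variable {α : Type*} [MeasurableSpace α]

/-- The transition probabilities of `K` and `L` from a common state differ by at most `η`, tested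
against measurable functions with values in `[0, 1]`. -/
def KernelsWithin (η : ℝ) (K L : Kernel α α) : Prop :=
  ∀ x, ∀ g : α → ℝ, Measurable g → (∀ y, g y ∈ Set.Icc 0 1) →
    |∫ y, g y ∂K x - ∫ y, g y ∂L x| ≤ η

theorem integral_mem_Icc {β : Type*} [MeasurableSpace β] {μ : Measure β} [IsProbabilityMeasure μ]
    {g : β → ℝ} (h : ∀ y, g y ∈ Set.Icc (0 : ℝ) 1) : ∫ y, g y ∂μ ∈ Set.Icc (0 : ℝ) 1 := by
  refine ⟨integral_nonneg fun y => (h y).1, ?_⟩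
  simpa using integral_mono_of_nonneg (ae_of_all μ fun y => (h y).1) (integrable_const (1 : ℝ))
    (ae_of_all μ fun y => (h y).2)

theorem integrable_of_mem_unit {β : Type*} [MeasurableSpace β] {μ : Measure β} [IsFiniteMeasure μ]
    {g : β → ℝ} (hg : Measurable g) (h : ∀ y, g y ∈ Set.Icc (0 : ℝ) 1) : Integrable g μ :=
  integrable_of_mem_Icc hg (ae_of_all μ h)

/-- The joint law of an `m`-measurable variable `Z` and a variable whose conditional law given `m`
is a function of `Z`. -/
theorem map_prodMk_eq_compProd {Ω γ : Type*} {m mΩ : MeasurableSpace Ω} [MeasurableSpace γ]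
    {P : Measure Ω} [IsProbabilityMeasure P] (hm : m ≤ mΩ) {Z : Ω → γ} (hZ : Measurable[m] Z)
    {Y : Ω → α} (hY : Measurable Y) (L : Kernel γ α) [IsMarkovKernel L]
    (h : ∀ A : Set α, MeasurableSet A →
      P[(Y ⁻¹' A).indicator (fun _ => (1 : ℝ)) | m] =ᵐ[P] fun ω => (L (Z ω)).real A) :
    P.map (fun ω => (Z ω, Y ω)) = P.map Z ⊗ₘ L := by
  have hZ' : Measurable Z := hZ.mono hm le_rfl
  have := Measure.isProbabilityMeasure_map (μ := P) hZ'.aemeasurable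
  have := Measure.isProbabilityMeasure_map (μ := P) (hZ'.prodMk hY).aemeasurable
  refine Measure.ext_prod fun {B A} hB hA => ?_
  rw [Measure.map_apply (hZ'.prodMk hY) (hB.prod hA), Measure.compProd_apply_prod hB hA,
    setLIntegral_map hB (L.measurable_coe hA) hZ']
  have hYA : MeasurableSet (Y ⁻¹' A) := hY hA
  have h1 : ∫ ω in Z ⁻¹' B, (L (Z ω)).real A ∂P = P.real (Z ⁻¹' B ∩ Y ⁻¹' A) := by
    rw [← setIntegral_congr_ae (hZ' hB) ((h A hA).mono fun ω hω _ => hω),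
      setIntegral_condExp hm ((integrable_const (1 : ℝ)).indicator hYA) (hZ hB),
      setIntegral_indicator hYA]
    simp
  rw [← ENNReal.toReal_eq_toReal_iff' (measure_ne_top _ _), ← integral_toReal]
  · exact h1.symm
  · exact ((L.measurable_coe hA).comp hZ').aemeasurable
  · simp
  · refine ne_top_of_le_ne_top ENNReal.one_ne_top ?_
    calc ∫⁻ ω in Z ⁻¹' B, L (Z ω) A ∂P
        ≤ ∫⁻ ω in Z ⁻¹' B, 1 ∂P := lintegral_mono fun ω => prob_le_one
      _ ≤ 1 := by simpa using prob_le_one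

theorem integral_eq_integral_kernel {Ω γ : Type*} {m mΩ : MeasurableSpace Ω} [MeasurableSpace γ]
    {P : Measure Ω} [IsProbabilityMeasure P] (hm : m ≤ mΩ) {Z : Ω → γ} (hZ : Measurable[m] Z)
    {Y : Ω → α} (hY : Measurable Y) (L : Kernel γ α) [IsMarkovKernel L]
    (h : ∀ A : Set α, MeasurableSet A →
      P[(Y ⁻¹' A).indicator (fun _ => (1 : ℝ)) | m] =ᵐ[P] fun ω => (L (Z ω)).real A)
    {g : γ × α → ℝ} (hg : Measurable g) (hg01 : ∀ z, g z ∈ Set.Icc 0 1) :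
    ∫ ω, g (Z ω, Y ω) ∂P = ∫ ω, ∫ y, g (Z ω, y) ∂L (Z ω) ∂P := by
  have hZ' : Measurable Z := hZ.mono hm le_rfl
  have := Measure.isProbabilityMeasure_map (μ := P) hZ'.aemeasurable
  have h1 := map_prodMk_eq_compProd hm hZ hY L h
  have h2 : ∫ z, g z ∂(P.map fun ω => (Z ω, Y ω)) = ∫ ω, g (Z ω, Y ω) ∂P :=
    integral_map (hZ'.prodMk hY).aemeasurable hg.aestronglyMeasurable
  rw [← h2, h1, Measure.integral_compProd (integrable_of_mem_unit hg hg01),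
    integral_map hZ'.aemeasurable]
  exact (hg.stronglyMeasurable.integral_kernel_prod_right').aestronglyMeasurable

section JointMeasurability

variable {Θ : Type*} [MeasurableSpace Θ]

theorem measurable_pow_uncurry {K : Θ → Kernel α α} [∀ p, IsMarkovKernel (K p)]
    (hK : Measurable fun z : Θ × α => K z.1 z.2) (n : ℕ) :
    Measurable fun z : Θ × α => (K z.1 ^ n) z.2 := by
  induction n with
  | zero =>
    simp only [pow_zero]
    exact (Kernel.id (α := α)).measurable.comp measurable_snd
  | succ n ih =>
    let J : Kernel (Θ × α) α := ⟨fun z => K z.1 z.2, hK⟩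
    have : IsMarkovKernel J := ⟨fun z => inferInstanceAs (IsProbabilityMeasure (K z.1 z.2))⟩
    refine Measure.measurable_of_measurable_coe _ fun A hA => ?_
    have h1 : Measurable fun w : (Θ × α) × α => (K w.1.1 ^ n) w.2 A :=
      (Measure.measurable_coe hA).comp
        (ih.comp ((measurable_fst.comp measurable_fst).prodMk measurable_snd))
    have h2 := h1.lintegral_kernel_prod_right' (κ := J)
    refine (congrArg Measurable (funext fun z => ?_)).mpr h2
    rw [pow_succ_eq_comp, Kernel.comp_apply' _ _ _ hA]
    rfl

end JointMeasurability

/-- Convergence of an adaptive chain whose kernels `K p`, `p : Θ`, converge to `π` uniformly over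
`p` and over the starting point in `S`, depend uniformly continuously on `p`, and whose adaptation
diminishes. Freezing the parameter at time `h` and moving `n` steps on changes the law by a
telescoping sum of `n` terms, each bounded by the mean distance of two kernels at most `n` steps
apart. -/
theorem tendsto_tv_of_diminishing_adaptation {Θ : Type*} [PseudoMetricSpace Θ] [MeasurableSpace Θ]
    {S : Set α} {π : Measure α} {K : Θ → Kernel α α} [∀ p, IsMarkovKernel (K p)]
    (hK : Measurable fun z : Θ × α => K z.1 z.2)
    (hcont : ∀ η > 0, ∃ δ > 0, ∀ p p', dist p p' < δ → KernelsWithin η (K p) (K p'))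
    (herg : ∀ η > 0, ∃ n : ℕ, ∀ p, ∀ x ∈ S, ∀ A, MeasurableSet A →
      |((K p ^ n) x).real A - π.real A| ≤ η)
    {Ω : Type*} {mΩ : MeasurableSpace Ω} {P : Measure Ω} [IsProbabilityMeasure P]
    {ℱ : Filtration ℕ mΩ} {X : ℕ → Ω → α} {r : ℕ → Ω → Θ}
    (hX : ∀ h, Measurable[ℱ h] (X h)) (hr : ∀ h, Measurable[ℱ h] (r h))
    {h₀ : ℕ} (hXS : ∀ h, ∀ᵐ ω ∂P, X h ω ∈ S)
    (htrans : ∀ h ≥ h₀, ∀ A : Set α, MeasurableSet A →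
      P[(X (h + 1) ⁻¹' A).indicator (fun _ => (1 : ℝ)) | ℱ h]
        =ᵐ[P] fun ω => (K (r h ω) (X h ω)).real A)
    (hdim : ∀ δ > 0, Tendsto (fun h => P {ω | δ ≤ dist (r (h + 1) ω) (r h ω)}) atTop (𝓝 0)) :
    Tendsto (fun h => tv (P.map (X h)) π) atTop (𝓝 0) := by
  have hXm : ∀ h, Measurable (X h) := fun h => (hX h).mono (ℱ.le h) le_rfl
  have hrm : ∀ h, Measurable (r h) := fun h => (hr h).mono (ℱ.le h) le_rfl
  have hpowMarkov : ∀ p n, IsMarkovKernel (K p ^ n) := fun p n => isMarkovKernel_pow (K p) n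
  let J : Kernel (Θ × α) α := ⟨fun z => K z.1 z.2, hK⟩
  have hJ : IsMarkovKernel J := ⟨fun z => inferInstanceAs (IsProbabilityMeasure (K z.1 z.2))⟩
  -- multi-step increments of the parameters also tend to zero in probability
  have hdimj : ∀ j : ℕ, ∀ δ > 0,
      Tendsto (fun h => P.real {ω | δ ≤ dist (r (h + j) ω) (r h ω)}) atTop (𝓝 0) := by
    have key : ∀ j : ℕ, ∀ δ > 0,
        Tendsto (fun h => P {ω | δ ≤ dist (r (h + j) ω) (r h ω)}) atTop (𝓝 0) := by
      intro j
      induction j with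
      | zero =>
        intro δ hδ
        simp [not_le.2 hδ]
      | succ j ih =>
        intro δ hδ
        have h1 := ((hdim (δ / 2) (by positivity)).comp (tendsto_add_atTop_nat j)).add
          (ih (δ / 2) (by positivity))
        rw [add_zero] at h1
        refine tendsto_of_tendsto_of_tendsto_of_le_of_le tendsto_const_nhds h1
          (fun _ => zero_le) fun h => ?_
        refine (measure_mono fun ω (hω : δ ≤ _) => ?_).trans (measure_union_le _ _)
        by_contra hcon
        simp only [Set.mem_union, Set.mem_ofPred_eq, not_or, not_le] at hcon
        have h2 := dist_triangle (r (h + j + 1) ω) (r (h + j) ω) (r h ω)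
        exact absurd hω (not_le.2 (by rw [← add_assoc]; linarith [hcon.1, hcon.2]))
    intro j δ hδ
    have := (ENNReal.tendsto_toReal ENNReal.zero_ne_top).comp (key j δ hδ)
    simpa [Function.comp_def, measureReal_def] using this
  -- one term of the telescoping sum
  have hterm : ∀ h ≥ h₀, ∀ j m : ℕ, ∀ A, MeasurableSet A → ∀ η > 0, ∀ δ > 0,
      (∀ p p', dist p p' < δ → KernelsWithin η (K p) (K p')) →
      |∫ ω, ((K (r h ω) ^ m) (X (h + j + 1) ω)).real A ∂P
        - ∫ ω, ((K (r h ω) ^ (m + 1)) (X (h + j) ω)).real A ∂P|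
        ≤ η + P.real {ω | δ ≤ dist (r (h + j) ω) (r h ω)} := by
    intro h hh j m A hA η hη δ hδ hclose
    let f : Θ × α → ℝ := fun z => ((K z.1 ^ m) z.2).real A
    have hf : Measurable f :=
      ((Measure.measurable_coe hA).comp (measurable_pow_uncurry hK m)).ennreal_toReal
    have hf01 : ∀ z, f z ∈ Set.Icc 0 1 := fun z =>
      ⟨measureReal_nonneg, measureReal_le_one⟩
    have hrh : Measurable[ℱ (h + j)] (r h) := (hr h).mono (ℱ.mono (Nat.le_add_right h j)) le_rfl
    let Z : Ω → Θ × (Θ × α) := fun ω => (r h ω, r (h + j) ω, X (h + j) ω)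
    have hZ : Measurable[ℱ (h + j)] Z := hrh.prodMk ((hr (h + j)).prodMk (hX (h + j)))
    have hZm : Measurable Z := hZ.mono (ℱ.le _) le_rfl
    have h1 : ∫ ω, f (r h ω, X (h + j + 1) ω) ∂P
        = ∫ ω, ∫ y, f (r h ω, y) ∂K (r (h + j) ω) (X (h + j) ω) ∂P :=
      integral_eq_integral_kernel (ℱ.le (h + j)) hZ (hXm (h + j + 1))
        (J.comap Prod.snd measurable_snd)
        (htrans (h + j) (hh.trans (Nat.le_add_right h j)))
        (g := fun w => f (w.1.1, w.2))
        (hf.comp ((measurable_fst.comp measurable_fst).prodMk measurable_snd)) fun w => hf01 _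
    have h2 : ∀ ω, ((K (r h ω) ^ (m + 1)) (X (h + j) ω)).real A
        = ∫ y, f (r h ω, y) ∂K (r h ω) (X (h + j) ω) := fun ω => by
      rw [pow_succ_eq_comp, real_comp_apply _ _ _ hA]
    simp_rw [h2]
    change |∫ ω, f (r h ω, X (h + j + 1) ω) ∂P - _| ≤ _
    rw [h1]
    have hfz : ∀ p, Measurable fun y => f (p, y) := fun p => hf.comp measurable_prodMk_left
    -- averages of `f (p, ·)` over a step from `(p', x)` depend measurably on `(p, p', x)`
    have hmeas : Measurable fun w : Θ × (Θ × α) => ∫ y, f (w.1, y) ∂K w.2.1 w.2.2 :=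
      (StronglyMeasurable.integral_kernel_prod_right' (κ := J.comap Prod.snd measurable_snd)
        (f := fun w : (Θ × (Θ × α)) × α => f (w.1.1, w.2))
        (hf.comp ((measurable_fst.comp measurable_fst).prodMk
          measurable_snd)).stronglyMeasurable).measurable
    have hi1 : Integrable (fun ω => ∫ y, f (r h ω, y) ∂K (r (h + j) ω) (X (h + j) ω)) P :=
      integrable_of_mem_unit (hmeas.comp hZm) fun ω => integral_mem_Icc fun y => hf01 _
    have hi2 : Integrable (fun ω => ∫ y, f (r h ω, y) ∂K (r h ω) (X (h + j) ω)) P :=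
      integrable_of_mem_unit (hmeas.comp ((hrm h).prodMk ((hrm h).prodMk (hXm (h + j)))))
        fun ω => integral_mem_Icc fun y => hf01 _
    rw [← integral_sub hi1 hi2]
    set B := {ω | δ ≤ dist (r (h + j) ω) (r h ω)} with hB
    -- distances of the parameters need not be measurable, so `B` is replaced by a hull
    have hBm := measurableSet_toMeasurable P B
    calc |∫ ω, (∫ y, f (r h ω, y) ∂K (r (h + j) ω) (X (h + j) ω)
          - ∫ y, f (r h ω, y) ∂K (r h ω) (X (h + j) ω)) ∂P|
        ≤ ∫ ω, |∫ y, f (r h ω, y) ∂K (r (h + j) ω) (X (h + j) ω)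
          - ∫ y, f (r h ω, y) ∂K (r h ω) (X (h + j) ω)| ∂P := abs_integral_le_integral_abs
      _ ≤ ∫ ω, (η + (toMeasurable P B).indicator (fun _ => (1 : ℝ)) ω) ∂P := by
          refine integral_mono (hi1.sub hi2).abs
            ((integrable_const η).add ((integrable_const (1 : ℝ)).indicator hBm)) fun ω => ?_
          by_cases hω : ω ∈ toMeasurable P B
          · have h3 := integral_mem_Icc (μ := K (r (h + j) ω) (X (h + j) ω))
              fun y => hf01 (r h ω, y)
            have h4 := integral_mem_Icc (μ := K (r h ω) (X (h + j) ω)) fun y => hf01 (r h ω, y)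
            simp only [Set.indicator_of_mem hω, abs_le]
            constructor <;> linarith [h3.1, h3.2, h4.1, h4.2]
          · have h3 : dist (r (h + j) ω) (r h ω) < δ :=
              not_le.1 fun h' => hω (subset_toMeasurable P B h')
            simpa [Set.indicator_of_notMem hω] using
              hclose _ _ h3 (X (h + j) ω) _ (hfz (r h ω)) fun y => hf01 _
      _ = η + P.real B := by
          rw [integral_add (integrable_const η) ((integrable_const (1 : ℝ)).indicator hBm),
            integral_indicator_const _ hBm]
          simp [measureReal_def]
  refine ENNReal.tendsto_nhds_zero.2 fun t ht => ?_
  obtain ⟨s, hs, hst⟩ : ∃ s : ℝ, 0 < s ∧ ENNReal.ofReal s ≤ t := by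
    rcases eq_or_ne t ⊤ with rfl | ht'
    · exact ⟨1, one_pos, le_top⟩
    · exact ⟨t.toReal, ENNReal.toReal_pos ht.ne' ht', ENNReal.ofReal_toReal_le⟩
  obtain ⟨n, hn⟩ := herg (s / 2) (by positivity)
  obtain ⟨δ, hδ, hclose⟩ := hcont (s / (4 * (n + 1))) (by positivity)
  have hsum : Tendsto (fun h => ∑ j ∈ Finset.range n,
      (s / (4 * (n + 1)) + P.real {ω | δ ≤ dist (r (h + j) ω) (r h ω)})) atTop
      (𝓝 (∑ _j ∈ Finset.range n, (s / (4 * (n + 1)) + 0))) :=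
    tendsto_finsetSum _ fun j _ => (hdimj j δ hδ).const_add _
  have hlim : ∑ _j ∈ Finset.range n, (s / (4 * ((n : ℝ) + 1)) + 0) < s / 2 := by
    rw [Finset.sum_const, Finset.card_range, nsmul_eq_mul, add_zero, ← mul_div_assoc,
      div_lt_div_iff₀ (by positivity) two_pos]
    nlinarith
  rw [← map_add_atTop_eq_nat n, eventually_map]
  filter_upwards [hsum.eventually_lt_const hlim, eventually_ge_atTop h₀] with h hh hh₀
  refine le_trans (iSup₂_le fun A hA => ENNReal.ofReal_le_ofReal ?_) hst
  have htel : ∀ k ≤ n, |∫ ω, ((K (r h ω) ^ (n - k)) (X (h + k) ω)).real A ∂P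
      - ∫ ω, ((K (r h ω) ^ n) (X h ω)).real A ∂P|
      ≤ ∑ j ∈ Finset.range k,
        (s / (4 * (n + 1)) + P.real {ω | δ ≤ dist (r (h + j) ω) (r h ω)}) := by
    intro k hk
    induction k with
    | zero => simp
    | succ k ih =>
      have h1 := hterm h hh₀ k (n - (k + 1)) A hA _ (by positivity) δ hδ hclose
      rw [show n - (k + 1) + 1 = n - k by omega] at h1
      rw [Finset.sum_range_succ]
      refine (abs_sub_le _ (∫ ω, ((K (r h ω) ^ (n - k)) (X (h + k) ω)).real A ∂P) _).trans ?_
      exact (add_le_add h1 (ih (by omega))).trans_eq (add_comm _ _)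
  have hend := htel n le_rfl
  rw [Nat.sub_self] at hend
  have hP : ∫ ω, ((K (r h ω) ^ 0) (X (h + n) ω)).real A ∂P = (P.map (X (h + n))).real A := by
    have h1 : ∀ ω, ((K (r h ω) ^ 0) (X (h + n) ω)).real A
        = (X (h + n) ⁻¹' A).indicator (fun _ => (1 : ℝ)) ω := fun ω => by
      rw [pow_zero]
      change (Kernel.id (X (h + n) ω)).real A = _
      rw [Kernel.id_apply, measureReal_def, Measure.dirac_apply' _ hA]
      by_cases hω : X (h + n) ω ∈ A <;> simp [hω]
    simp_rw [h1]
    rw [integral_indicator_const _ (hXm _ hA), map_measureReal_apply (hXm _) hA]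
    simp
  rw [hP] at hend
  have hf : Measurable fun ω => ((K (r h ω) ^ n) (X h ω)).real A :=
    ((Measure.measurable_coe hA).comp
      ((measurable_pow_uncurry hK n).comp ((hrm h).prodMk (hXm h)))).ennreal_toReal
  have hfrozen : |∫ ω, ((K (r h ω) ^ n) (X h ω)).real A ∂P - π.real A| ≤ s / 2 := by
    have hi : Integrable (fun ω => ((K (r h ω) ^ n) (X h ω)).real A) P :=
      integrable_of_mem_unit hf fun ω => ⟨measureReal_nonneg, measureReal_le_one⟩
    have h1 : ∫ ω, ((K (r h ω) ^ n) (X h ω)).real A ∂P - π.real A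
        = ∫ ω, (((K (r h ω) ^ n) (X h ω)).real A - π.real A) ∂P := by
      rw [integral_sub hi (integrable_const _)]
      simp
    rw [h1]
    refine abs_integral_le_integral_abs.trans ?_
    have h2 := integral_mono_ae (hi.sub (integrable_const (π.real A))).abs
      (integrable_const (μ := P) (s / 2)) ((hXS h).mono fun ω hω => hn (r h ω) _ hω A hA)
    simpa using h2
  refine (abs_sub_le _ (∫ ω, ((K (r h ω) ^ n) (X h ω)).real A ∂P) _).trans ?_
  linarith

end Adaptive

/-! ### Mixtures of kernels with adapted weights -/

section Mixtures

variable {α ι : Type*} [MeasurableSpace α] [Fintype ι]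

theorem mixture_apply_apply (w : ι → ℝ) (G : ι → Kernel α α) (x : α) (A : Set α) :
    mixture w G x A = ∑ i, ENNReal.ofReal (w i) * G i x A := by
  change (∑ i, ENNReal.ofReal (w i) • G i x) A = _
  simp

theorem absorbing_mixture {S : Set α} (w : ι → ℝ) {G : ι → Kernel α α}
    (hG : ∀ i, ∀ x ∈ S, G i x Sᶜ = 0) : ∀ x ∈ S, mixture w G x Sᶜ = 0 := fun x hx => by
  rw [mixture_apply_apply]
  exact Finset.sum_eq_zero fun i _ => by rw [hG i x hx, mul_zero]

theorem isMarkovKernel_mixture {w : ι → ℝ} (hw : ∀ i, 0 ≤ w i) (hw1 : ∑ i, w i = 1)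
    {G : ι → Kernel α α} (hG : ∀ i, IsMarkovKernel (G i)) : IsMarkovKernel (mixture w G) := by
  refine ⟨fun x => ⟨?_⟩⟩
  rw [mixture_apply_apply]
  simp only [measure_univ, mul_one]
  rw [← ENNReal.ofReal_sum_of_nonneg fun i _ => hw i, hw1, ENNReal.ofReal_one]

theorem sum_ofReal_mul_const {w : ι → ℝ} (hw : ∀ i, 0 ≤ w i) (hw1 : ∑ i, w i = 1) (t : ℝ≥0∞) :
    ∑ i, ENNReal.ofReal (w i) * t = t := by
  rw [← Finset.sum_mul, ← ENNReal.ofReal_sum_of_nonneg fun i _ => hw i, hw1, ENNReal.ofReal_one,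
    one_mul]

theorem Compatible.mixture {S : Set α} {π : Measure α} {w : ι → ℝ} (hw : ∀ i, 0 ≤ w i)
    (hw1 : ∑ i, w i = 1) {G : ι → Kernel α α} (hG : ∀ i, Compatible S π (G i)) :
    Compatible S π (mixture w G) where
  isMarkov := isMarkovKernel_mixture hw hw1 fun i => (hG i).isMarkov
  invariant := by
    refine Measure.ext fun A hA => ?_
    rw [Measure.bind_apply hA (Kernel.aemeasurable _)]
    simp only [mixture_apply_apply]
    rw [lintegral_finsetSum _ fun i _ => ((G i).measurable_coe hA).const_mul _]
    simp_rw [lintegral_const_mul _ ((G _).measurable_coe hA),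
      ← Measure.bind_apply hA (Kernel.aemeasurable _), (hG _).invariant.def]
    exact sum_ofReal_mul_const hw hw1 _
  absorbing := absorbing_mixture w fun i => (hG i).absorbing

theorem integral_mixture {w : ι → ℝ} (hw : ∀ i, 0 ≤ w i) {G : ι → Kernel α α}
    (hG : ∀ i, IsMarkovKernel (G i)) (x : α) {g : α → ℝ} (hg : Measurable g)
    (hg01 : ∀ y, g y ∈ Set.Icc (0 : ℝ) 1) :
    ∫ y, g y ∂mixture w G x = ∑ i, w i * ∫ y, g y ∂G i x := by
  change ∫ y, g y ∂(∑ i, ENNReal.ofReal (w i) • G i x) = _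
  rw [integral_finsetSum_measure fun i _ =>
    (integrable_of_mem_unit hg hg01).smul_measure ENNReal.ofReal_ne_top]
  refine Finset.sum_congr rfl fun i _ => ?_
  rw [integral_smul_measure, ENNReal.toReal_ofReal (hw i), smul_eq_mul]

theorem kernelsWithin_mixture {w w' : ι → ℝ} (hw : ∀ i, 0 ≤ w i) (hw' : ∀ i, 0 ≤ w' i)
    {G : ι → Kernel α α} (hG : ∀ i, IsMarkovKernel (G i)) :
    KernelsWithin (∑ i, |w i - w' i|) (mixture w G) (mixture w' G) := by
  intro x g hg hg01
  rw [integral_mixture hw hG x hg hg01, integral_mixture hw' hG x hg hg01,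
    ← Finset.sum_sub_distrib]
  refine (Finset.abs_sum_le_sum_abs _ _).trans (Finset.sum_le_sum fun i _ => ?_)
  have h := integral_mem_Icc (μ := G i x) hg01
  rw [← sub_mul, abs_mul, abs_of_nonneg h.1]
  exact mul_le_of_le_one_right (abs_nonneg _) h.2

theorem integral_comp_unit {K L : Kernel α α} [IsMarkovKernel K] [IsMarkovKernel L] (x : α)
    {g : α → ℝ} (hg : Measurable g) (hg01 : ∀ y, g y ∈ Set.Icc (0 : ℝ) 1) :
    ∫ y, g y ∂(L ∘ₖ K) x = ∫ y, ∫ z, g z ∂L y ∂K x :=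
  Kernel.integral_comp (integrable_of_mem_unit hg hg01)

theorem KernelsWithin.comp {η₁ η₂ : ℝ} {K K' L L' : Kernel α α} [IsMarkovKernel K]
    [IsMarkovKernel K'] [IsMarkovKernel L] [IsMarkovKernel L'] (hL : KernelsWithin η₁ L L')
    (hK : KernelsWithin η₂ K K') : KernelsWithin (η₁ + η₂) (L ∘ₖ K) (L' ∘ₖ K') := by
  intro x g hg hg01
  rw [integral_comp_unit x hg hg01, integral_comp_unit x hg hg01]
  have hmeas : ∀ (M : Kernel α α) [IsMarkovKernel M], Measurable fun y => ∫ z, g z ∂M y :=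
    fun M _ => (hg.stronglyMeasurable.integral_kernel (κ := M)).measurable
  have h01 : ∀ (M : Kernel α α) [IsMarkovKernel M] (y : α), ∫ z, g z ∂M y ∈ Set.Icc (0 : ℝ) 1 :=
    fun M _ y => integral_mem_Icc hg01
  have hi : ∀ (M : Kernel α α) [IsMarkovKernel M], Integrable (fun y => ∫ z, g z ∂M y) (K x) :=
    fun M _ => integrable_of_mem_unit (hmeas M) (h01 M)
  refine (abs_sub_le _ (∫ y, ∫ z, g z ∂L' y ∂K x) _).trans
    (add_le_add ?_ (hK x _ (hmeas L') (h01 L')))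
  rw [← integral_sub (hi L) (hi L')]
  refine abs_integral_le_integral_abs.trans ?_
  have h := integral_mono ((hi L).sub (hi L')).abs (integrable_const (μ := K x) η₁)
    fun y => hL y g hg hg01
  simpa using h

theorem KernelsWithin.pow {η : ℝ} {K L : Kernel α α} [IsMarkovKernel K] [IsMarkovKernel L]
    (h : KernelsWithin η K L) (n : ℕ) : KernelsWithin (n * η) (K ^ n) (L ^ n) := by
  induction n with
  | zero => intro x g _ _; simp
  | succ n ih =>
    have := isMarkovKernel_pow K n
    have := isMarkovKernel_pow L n
    rw [pow_succ_eq_comp, pow_succ_eq_comp]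
    convert ih.comp h using 1
    push_cast
    ring

theorem measurable_mixture_uncurry {Θ : Type*} [MeasurableSpace Θ] {w : Θ → ι → ℝ}
    (hw : ∀ i, Measurable fun p => w p i) (G : ι → Kernel α α) :
    Measurable fun z : Θ × α => mixture (w z.1) G z.2 := by
  refine Measure.measurable_of_measurable_coe _ fun A hA => ?_
  simp only [mixture_apply_apply]
  exact Finset.measurable_sum _ fun i _ =>
    ((hw i).comp measurable_fst).ennreal_ofReal.mul
      (((G i).measurable_coe hA).comp measurable_snd)

/-- The states of an adaptive chain stay in a set that no kernel of the family leaves. -/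
theorem IsAdaptiveChain.ae_mem {N : ℕ} {Ω : Type*} {mΩ : MeasurableSpace Ω} {P : Measure Ω}
    [IsProbabilityMeasure P] {ℱ : Filtration ℕ mΩ} {K : (Fin N → ℝ) → Kernel α α}
    {X : ℕ → Ω → α} {r : ℕ → Ω → Fin N → ℝ} (hchain : IsAdaptiveChain P ℱ K X r)
    {S : Set α} (hS : MeasurableSet S) (hK : ∀ p, ∀ x ∈ S, K p x Sᶜ = 0)
    (hX₀ : ∀ᵐ ω ∂P, X 0 ω ∈ S) (h : ℕ) : ∀ᵐ ω ∂P, X h ω ∈ S := by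
  induction h with
  | zero => exact hX₀
  | succ h ih =>
    have hm : MeasurableSet (X (h + 1) ⁻¹' Sᶜ) :=
      ((hchain.measurable_state (h + 1)).mono (ℱ.le _) le_rfl) hS.compl
    have h1 : P.real (X (h + 1) ⁻¹' Sᶜ) = 0 := by
      rw [← mul_one (P.real _), ← smul_eq_mul, ← integral_indicator_const (1 : ℝ) hm,
        ← integral_condExp (ℱ.le h), integral_congr_ae (hchain.transition h Sᶜ hS.compl)]
      refine integral_eq_zero_of_ae (ih.mono fun ω hω => ?_)
      simp [measureReal_def, hK (r h ω) (X h ω) hω]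
    exact (measureReal_eq_zero_iff (measure_ne_top _ _)).1 h1

/-- Convergence of an adaptive chain that makes `V` draws per iteration from a mixture of fixed
kernels whose weights depend continuously on the adapted parameter in a compact set `D`. -/
theorem IsAdaptiveChain.tendsto_tv_of_mixture {N : ℕ} {Ω : Type*} {mΩ : MeasurableSpace Ω}
    {P : Measure Ω} [IsProbabilityMeasure P] {ℱ : Filtration ℕ mΩ} {X : ℕ → Ω → α}
    {r : ℕ → Ω → Fin N → ℝ} {w : (Fin N → ℝ) → ι → ℝ} {G : ι → Kernel α α} {V : ℕ} (hV : 1 ≤ V)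
    (hchain : IsAdaptiveChain P ℱ (fun p => mixture (w p) G ^ V) X r)
    {S : Set α} (hS : MeasurableSet S) {π : Measure α} [IsProbabilityMeasure π] (hπS : π Sᶜ = 0)
    (hG : ∀ i, Compatible S π (G i)) {D : Set (Fin N → ℝ)} (hD : IsCompact D)
    (hwc : ∀ i, ContinuousOn (fun p => w p i) D) (hw : ∀ p ∈ D, ∀ i, 0 ≤ w p i)
    (hw1 : ∀ p ∈ D, ∑ i, w p i = 1) {L : Kernel α α} (hL : UniformlyErgodicOn S L π)
    {c : ℝ} (hc : 0 < c)
    (hmin : ∀ p ∈ D, ∀ x A, MeasurableSet A → ENNReal.ofReal c * L x A ≤ mixture (w p) G x A)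
    (hX₀ : ∀ᵐ ω ∂P, X 0 ω ∈ S) {h₀ : ℕ} (hr : ∀ h ≥ h₀, ∀ᵐ ω ∂P, r h ω ∈ D)
    (hdim : TendstoInMeasure P (fun h ω => r (h + 1) ω - r h ω) atTop (fun _ => 0)) :
    Tendsto (fun h => tv (P.map (X h)) π) atTop (𝓝 0) := by
  classical
  obtain ⟨ω₀, hω₀⟩ := (hr h₀ le_rfl).exists
  have hDm : MeasurableSet D := hD.isClosed.measurableSet
  -- a measurable retraction onto `D`; it changes the parameters on a null set only
  let Φ : (Fin N → ℝ) → D := fun p => ⟨if p ∈ D then p else r h₀ ω₀, by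
    split_ifs with h
    exacts [h, hω₀]⟩
  have hΦ : Measurable Φ := (Measurable.ite hDm measurable_id measurable_const).subtype_mk
  have hΦD : ∀ p ∈ D, (Φ p : Fin N → ℝ) = p := fun p hp => if_pos hp
  have hGM : ∀ i, IsMarkovKernel (G i) := fun i => (hG i).isMarkov
  let K : D → Kernel α α := fun p => mixture (w p) G
  have hK : ∀ p, Compatible S π (K p) := fun p => Compatible.mixture (hw p p.2) (hw1 p p.2) hG
  have hKM : ∀ p, IsMarkovKernel (K p) := fun p => (hK p).isMarkov
  have hKV : ∀ p, IsMarkovKernel (K p ^ V) := fun p => isMarkovKernel_pow (K p) V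
  have hwD : ∀ i, Continuous fun p : D => w p i := fun i => (hwc i).domRestrict
  have : CompactSpace D := isCompact_iff_compactSpace.1 hD
  have hcont : ∀ η > 0, ∃ δ > 0, ∀ p p' : D, dist p p' < δ →
      KernelsWithin η (K p ^ V) (K p' ^ V) := by
    intro η hη
    have hu : UniformContinuous fun p : D => w p :=
      CompactSpace.uniformContinuous_of_continuous (continuous_pi hwD)
    obtain ⟨δ, hδ, h⟩ := Metric.uniformContinuous_iff.1 hu
      (η / (V * (Fintype.card ι + 1))) (by positivity)
    refine ⟨δ, hδ, fun p p' hpp' x g hg hg01 =>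
      ((kernelsWithin_mixture (hw p p.2) (hw p' p'.2) hGM).pow V x g hg hg01).trans ?_⟩
    have h1 : ∑ i, |w p i - w p' i| ≤ ∑ _i : ι, η / (V * (Fintype.card ι + 1)) :=
      Finset.sum_le_sum fun i _ => ((dist_le_pi_dist (w p) (w p') i).trans (h hpp').le)
    have hV0 : (0 : ℝ) < V := by exact_mod_cast hV
    calc (V : ℝ) * ∑ i, |w p i - w p' i|
        ≤ V * ∑ _i : ι, η / (V * (Fintype.card ι + 1)) := by gcongr
      _ = η * (Fintype.card ι / (Fintype.card ι + 1)) := by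
          rw [Finset.sum_const, Finset.card_univ, nsmul_eq_mul]
          field_simp
      _ ≤ η := mul_le_of_le_one_right hη.le (div_le_one_of_le₀ (by linarith) (by positivity))
  refine tendsto_tv_of_diminishing_adaptation (Θ := D) (S := S) (K := fun p => K p ^ V)
    (ℱ := ℱ) (r := fun h ω => Φ (r h ω)) (h₀ := h₀) ?_ hcont ?_ hchain.measurable_state
    (fun h => hΦ.comp (hchain.measurable_prob h)) ?_ ?_ ?_
  · exact measurable_pow_uncurry (K := K)
      (measurable_mixture_uncurry (w := fun p : D => w p) (fun i => (hwD i).measurable) G) V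
  · exact fun η hη => exists_pow_close_of_minorization hS hπS hK hL hc (fun p => hmin p p.2) hV hη
  · exact fun h => hchain.ae_mem hS
      (fun p => absorbing_pow hS (absorbing_mixture (w p) fun i => (hG i).absorbing) V) hX₀ h
  · intro h hh A hA
    refine (hchain.transition h A hA).trans ((hr h hh).mono fun ω hω => ?_)
    simp only [K, hΦD _ hω]
  · intro δ hδ
    refine ((tendstoInMeasure_iff_dist.1 hdim) δ hδ).congr' ?_
    filter_upwards [eventually_ge_atTop h₀] with h hh
    refine measure_congr (Filter.eventuallyEq_set.2 ?_)
    filter_upwards [hr h hh, hr (h + 1) (by omega)] with ω h1 h2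
    simp only [Subtype.dist_eq, hΦD _ h1, hΦD _ h2, dist_eq_norm, sub_zero]

end Mixtures

/-! ### Gibbs steps and scans -/

section Gibbs

variable {N : ℕ} {E : Fin N → Type*} [∀ i, MeasurableSpace (E i)]

/-- The state with `i`-th coordinate `z.2` and with the other coordinates given by `z.1`. -/
def glue (i : Fin N) (z : (∀ j : {j : Fin N // j ≠ i}, E j.1) × E i) : ∀ j, E j := fun j =>
  if h : j = i then h ▸ z.2 else z.1 ⟨j, h⟩

theorem measurable_glue (i : Fin N) : Measurable (glue (E := E) i) := by
  refine measurable_pi_lambda _ fun j => ?_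
  by_cases h : j = i
  · subst h
    simpa [glue] using measurable_snd
  · simp only [glue, dif_neg h]
    exact (measurable_pi_apply (⟨j, h⟩ : {j : Fin N // j ≠ i})).comp measurable_fst

theorem update_eq_glue {N : ℕ} {E : Fin N → Type*} (i : Fin N) (x : ∀ j, E j) (y : E i) :
    Function.update x i y = glue i (others i x, y) := by
  funext j
  by_cases h : j = i
  · subst h
    simp [glue]
  · simp [glue, h, others]

variable {S : Set (∀ i, E i)} {π : Measure (∀ i, E i)}
  {κ : ∀ i : Fin N, Kernel (∀ j : {j : Fin N // j ≠ i}, E j.1) (E i)}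

theorem gibbsStep_apply [∀ i, IsMarkovKernel (κ i)] (i : Fin N) (x : ∀ j, E j) {A : Set (∀ j, E j)}
    (hA : MeasurableSet A) :
    gibbsStep i (κ i) x A = κ i (others i x) (Prod.mk (others i x) ⁻¹' (glue i ⁻¹' A)) := by
  have hm : Measurable fun p : (∀ j, E j) × E i => Function.update p.1 i p.2 := measurable_update'
  rw [gibbsStep, Kernel.map_apply' _ hm _ hA, Kernel.id_prod_apply' _ _ (hm hA),
    Kernel.comap_apply]
  simp_rw [update_eq_glue]
  rfl

/-- A Gibbs step leaves `π` invariant: `(x_{-i}, x_i)` has law `π_{-i} ⊗ κ`, and this is also the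
law after `x_i` has been redrawn from `κ`. -/
theorem compatible_gibbsStep [IsProbabilityMeasure π] [∀ i, IsMarkovKernel (κ i)] {i : Fin N}
    (hκ : IsFullConditional π i (κ i))
    (hκS : ∀ x ∈ S, gibbsStep i (κ i) x Sᶜ = 0) : Compatible S π (gibbsStep i (κ i)) where
  isMarkov := by
    have hm : Measurable fun p : (∀ j, E j) × E i => Function.update p.1 i p.2 :=
      measurable_update'
    rw [gibbsStep]
    exact Kernel.IsMarkovKernel.map _ hm
  invariant := by
    refine Measure.ext fun A hA => ?_
    have hA' := measurable_glue i hA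
    have hom := measurable_others (E := E) i
    rw [Measure.bind_apply hA (Kernel.aemeasurable _)]
    simp_rw [gibbsStep_apply i _ hA]
    have hmap : π.map (fun x => (others i x, x i)) = π.map (others i) ⊗ₘ κ i := hκ.map_eq
    rw [← lintegral_map (f := fun z => κ i z (Prod.mk z ⁻¹' (glue i ⁻¹' A)))
        (Kernel.measurable_kernel_prodMk_left hA') hom,
      ← Measure.compProd_apply hA', ← hmap,
      Measure.map_apply (hom.prodMk (measurable_pi_apply i)) hA']
    congr 1
    ext x
    simp [← update_eq_glue]
  absorbing := hκS

theorem compatible_scan (hS : MeasurableSet S) (hG : ∀ i, Compatible S π (gibbsStep i (κ i)))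
    (l : List (Fin N)) : Compatible S π (scan κ l) := by
  induction l with
  | nil => exact Compatible.id S π hS
  | cons i l ih => exact ih.comp hS (hG i)

end Gibbs

/-! ### The selection weights -/

section Weights

variable {N : ℕ}

/-- The selection probabilities between `ε` and `1`, and at most `1 - δ` for coordinates in `B`. -/
def selectionBox (ε δ : ℝ) (B : Finset (Fin N)) : Set (Fin N → ℝ) :=
  Set.univ.pi fun i => Set.Icc ε (if i ∈ B then 1 - δ else 1)

theorem isCompact_selectionBox (ε δ : ℝ) (B : Finset (Fin N)) :
    IsCompact (selectionBox ε δ B) :=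
  isCompact_univ_pi fun _ => isCompact_Icc

theorem mem_selectionBox {ε δ : ℝ} {B : Finset (Fin N)} {p : Fin N → ℝ} :
    p ∈ selectionBox ε δ B ↔ (∀ i, ε ≤ p i) ∧ ∀ i, p i ≤ if i ∈ B then 1 - δ else 1 := by
  simp only [selectionBox, Set.mem_univ_pi, Set.mem_Icc, forall_and]

theorem mem_Icc_of_mem_selectionBox {ε δ : ℝ} (hδ : 0 ≤ δ) {B : Finset (Fin N)} {p : Fin N → ℝ}
    (hp : p ∈ selectionBox ε δ B) (i : Fin N) : p i ∈ Set.Icc ε 1 := by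
  obtain ⟨h1, h2⟩ := mem_selectionBox.1 hp
  refine ⟨h1 i, (h2 i).trans ?_⟩
  split_ifs <;> linarith

variable {ε : ℝ} {p : Fin N → ℝ}

theorem sum_pos_of_le (hN : 0 < N) (hε : 0 < ε) (hp : ∀ i, ε ≤ p i) : 0 < ∑ i, p i :=
  Finset.sum_pos (fun i _ => hε.trans_le (hp i)) ⟨⟨0, hN⟩, Finset.mem_univ _⟩

theorem div_sum_le_one (hN : 0 < N) (hε : 0 < ε) (hp : ∀ i, ε ≤ p i) (i : Fin N) :
    p i / ∑ j, p j ≤ 1 :=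
  div_le_one_of_le₀ (Finset.single_le_sum (fun j _ => (hε.trans_le (hp j)).le)
    (Finset.mem_univ i)) (sum_pos_of_le hN hε hp).le

theorem le_div_sum (hN : 0 < N) (hε : 0 < ε) (hp : ∀ i, p i ∈ Set.Icc ε 1) (i : Fin N) :
    ε / N ≤ p i / ∑ j, p j := by
  have h : ∑ j, p j ≤ N := by
    simpa using Finset.sum_le_sum fun j (_ : j ∈ Finset.univ) => (hp j).2
  exact div_le_div₀ (hε.le.trans (hp i).1) (hp i).1 (sum_pos_of_le hN hε fun j => (hp j).1) h

theorem prod_one_sub_lt_one (hN : 0 < N) (hε : 0 < ε) (hp : ∀ i, p i ∈ Set.Icc ε 1) :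
    ∏ i, (1 - p i) < 1 := by
  have hε1 : ε ≤ 1 := (hp ⟨0, hN⟩).1.trans (hp ⟨0, hN⟩).2
  calc ∏ i, (1 - p i) ≤ ∏ _i : Fin N, (1 - ε) :=
        Finset.prod_le_prod (fun i _ => by linarith [(hp i).2]) fun i _ => by linarith [(hp i).1]
    _ = (1 - ε) ^ N := by simp
    _ < 1 := pow_lt_one₀ (by linarith) (by linarith) hN.ne'

theorem selectProb_nonneg (hN : 0 < N) (hε : 0 < ε) (hp : ∀ i, p i ∈ Set.Icc ε 1)
    (T : Finset (Fin N)) : 0 ≤ selectProb p T := by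
  unfold selectProb
  split_ifs
  · exact div_nonneg (mul_nonneg (Finset.prod_nonneg fun i _ => hε.le.trans (hp i).1)
      (Finset.prod_nonneg fun i _ => by linarith [(hp i).2]))
      (by linarith [prod_one_sub_lt_one hN hε hp])
  · exact le_rfl

theorem sum_selectProb (hN : 0 < N) (hε : 0 < ε) (hp : ∀ i, p i ∈ Set.Icc ε 1) :
    ∑ T, selectProb p T = 1 := by
  have hd : 1 - ∏ i, (1 - p i) ≠ 0 := by linarith [prod_one_sub_lt_one hN hε hp]
  have hT : ∀ T : Finset (Fin N), selectProb p T
      = ((∏ i ∈ T, p i) * ∏ i ∈ Tᶜ, (1 - p i) - if T = ∅ then ∏ i, (1 - p i) else 0)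
        / (1 - ∏ i, (1 - p i)) := fun T => by
    rcases T.eq_empty_or_nonempty with rfl | h
    · simp [selectProb]
    · simp [selectProb, h, h.ne_empty]
  have hall : ∑ T : Finset (Fin N), (∏ i ∈ T, p i) * ∏ i ∈ Tᶜ, (1 - p i) = 1 := by
    have h := Finset.prod_add p (fun i => 1 - p i) Finset.univ
    simp only [add_sub_cancel, Finset.prod_const_one, Finset.powerset_univ,
      ← Finset.compl_eq_univ_sdiff] at h
    exact h.symm
  simp_rw [hT]
  rw [← Finset.sum_div, Finset.sum_sub_distrib, hall, Finset.sum_ite_eq' Finset.univ,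
    if_pos (Finset.mem_univ _), div_self hd]

theorem selectProb_le_one (hN : 0 < N) (hε : 0 < ε) (hp : ∀ i, p i ∈ Set.Icc ε 1)
    (T : Finset (Fin N)) : selectProb p T ≤ 1 :=
  (Finset.single_le_sum (fun T _ => selectProb_nonneg hN hε hp T) (Finset.mem_univ T)).trans_eq
    (sum_selectProb hN hε hp)

theorem le_selectProb (hN : 0 < N) (hε : 0 < ε) {δ : ℝ} (hδ : 0 < δ) {B : Finset (Fin N)}
    (hp : p ∈ selectionBox ε δ B) {T : Finset (Fin N)} (hT : T.Nonempty)
    (hTB : ∀ i ∉ T, i ∈ B) : min ε δ ^ N ≤ selectProb p T := by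
  have hp1 := mem_Icc_of_mem_selectionBox hδ.le hp
  have hm : 0 ≤ min ε δ := (lt_min hε hδ).le
  have hlt := prod_one_sub_lt_one hN hε hp1
  have hpos : 0 ≤ ∏ i, (1 - p i) := Finset.prod_nonneg fun i _ => by linarith [(hp1 i).2]
  have h1 : min ε δ ^ T.card ≤ ∏ i ∈ T, p i := by
    rw [← Finset.prod_const]
    exact Finset.prod_le_prod (fun _ _ => hm) fun i _ => (min_le_left _ _).trans (hp1 i).1
  have h2 : min ε δ ^ Tᶜ.card ≤ ∏ i ∈ Tᶜ, (1 - p i) := by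
    rw [← Finset.prod_const]
    refine Finset.prod_le_prod (fun _ _ => hm) fun i hi => (min_le_right _ _).trans ?_
    have h := (mem_selectionBox.1 hp).2 i
    rw [if_pos (hTB i (Finset.mem_compl.1 hi))] at h
    linarith
  have h3 : min ε δ ^ N = min ε δ ^ T.card * min ε δ ^ Tᶜ.card := by
    rw [← pow_add, Finset.card_add_card_compl, Fintype.card_fin]
  have h4 : min ε δ ^ N ≤ (∏ i ∈ T, p i) * ∏ i ∈ Tᶜ, (1 - p i) :=
    h3 ▸ mul_le_mul h1 h2 (pow_nonneg hm _) ((pow_nonneg hm _).trans h1)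
  rw [selectProb, if_pos hT, le_div_iff₀ (by linarith)]
  exact (mul_le_of_le_one_right (pow_nonneg hm _) (by linarith)).trans h4

theorem continuousOn_selectProb (hN : 0 < N) (hε : 0 < ε) {δ : ℝ} (hδ : 0 ≤ δ)
    (B T : Finset (Fin N)) : ContinuousOn (fun p => selectProb p T) (selectionBox ε δ B) := by
  unfold selectProb
  split_ifs
  · refine ContinuousOn.div (by fun_prop) (by fun_prop) fun p hp => ?_
    linarith [prod_one_sub_lt_one hN hε (mem_Icc_of_mem_selectionBox hδ hp)]
  · exact continuousOn_const

/-- A set of coordinates with positive selection probability contains every coordinate that is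
selected almost surely. -/
theorem selectProb_eq_zero {T : Finset (Fin N)} (h : ¬T.Nonempty ∨ ∃ i ∉ T, p i = 1) :
    selectProb p T = 0 := by
  rcases h with h | ⟨i, hi, hpi⟩
  · exact if_neg h
  · unfold selectProb
    split_ifs
    · rw [Finset.prod_eq_zero (Finset.mem_compl.2 hi) (by rw [hpi, sub_self]), mul_zero, zero_div]
    · rfl

end Weights

/-! ### Convergence of the two adaptive samplers -/

theorem mixture_minorization {α ι : Type*} [MeasurableSpace α] [Fintype ι] {w w' : ι → ℝ} {c : ℝ}
    (hc : 0 ≤ c) (h : ∀ i, c * w' i ≤ w i) (G : ι → Kernel α α) (x : α) (A : Set α) :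
    ENNReal.ofReal c * mixture w' G x A ≤ mixture w G x A := by
  rw [mixture_apply_apply, mixture_apply_apply, Finset.mul_sum]
  refine Finset.sum_le_sum fun i _ => ?_
  rw [← mul_assoc, ← ENNReal.ofReal_mul hc]
  gcongr
  exact h i

section Samplers

variable {N : ℕ} {E : Fin N → Type*} [∀ i, MeasurableSpace (E i)]

/-- A mixture of scans dominates the single-site sampler as soon as it gives weight to all the
scans of a single coordinate. -/
theorem rsg_minorization {κ : ∀ i : Fin N, Kernel (∀ j : {j : Fin N // j ≠ i}, E j.1) (E i)}
    {p : Fin N → ℝ} (hp : ∀ i, p i / ∑ j, p j ≤ 1) {w : Finset (Fin N) → ℝ}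
    {m : ℝ} (h : ∀ i, m ≤ w {i}) (x : ∀ i, E i) (A : Set (∀ i, E i)) :
    ENNReal.ofReal m * rsg κ p x A ≤ mixture w (fun T => scan κ (T.sort (· ≤ ·))) x A := by
  rw [rsg, mixture_apply_apply, mixture_apply_apply, Finset.mul_sum]
  calc ∑ i, ENNReal.ofReal m * (ENNReal.ofReal (p i / ∑ j, p j) * gibbsStep i (κ i) x A)
      ≤ ∑ i, ENNReal.ofReal (w {i}) * scan κ (({i} : Finset (Fin N)).sort (· ≤ ·)) x A := by
        refine Finset.sum_le_sum fun i _ => ?_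
        have h1 : scan κ [i] = gibbsStep i (κ i) := Kernel.id_comp _
        rw [Finset.sort_singleton, h1]
        refine mul_le_mul' (ENNReal.ofReal_le_ofReal (h i)) (mul_le_of_le_one_left' ?_)
        exact ENNReal.ofReal_le_one.2 (hp i)
    _ = ∑ T ∈ Finset.univ.map ⟨singleton, Finset.singleton_injective⟩,
          ENNReal.ofReal (w T) * scan κ (T.sort (· ≤ ·)) x A := by
        rw [Finset.sum_map]
        rfl
    _ ≤ _ := Finset.sum_le_sum_of_subset (Finset.subset_univ _)

variable {S : Set (∀ i, E i)} {π : Measure (∀ i, E i)} [IsProbabilityMeasure π]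
  {κ : ∀ i : Fin N, Kernel (∀ j : {j : Fin N // j ≠ i}, E j.1) (E i)}
  {Ω : Type*} {mΩ : MeasurableSpace Ω} {P : Measure Ω} [IsProbabilityMeasure P]
  {ℱ : Filtration ℕ mΩ} {X : ℕ → Ω → ∀ i, E i} {q : ℕ → Ω → Fin N → ℝ} {ε : ℝ}

theorem tendsto_tv_adaptive_rsg (hN : 0 < N) (hS : MeasurableSet S) (hπS : π Sᶜ = 0)
    (hG : ∀ i, Compatible S π (gibbsStep i (κ i))) (hε : 0 < ε)
    (hX₀ : ∀ᵐ ω ∂P, X 0 ω ∈ S) (hq : ∀ h, ∀ᵐ ω ∂P, ∀ i, q h ω i ∈ Set.Icc ε 1)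
    (ha : TendstoInMeasure P (fun h ω => q (h + 1) ω - q h ω) atTop (fun _ => 0))
    {V : ℕ} (hV : 1 ≤ V) {p : Fin N → ℝ} (hp : ∀ i, p i ∈ Set.Icc ε 1)
    (hL : UniformlyErgodicOn S (rsg κ p) π)
    (hchain : IsAdaptiveChain P ℱ (fun p => rsg κ p ^ V) X q) :
    Tendsto (fun h => tv (P.map (X h)) π) atTop (𝓝 0) := by
  have hD : ∀ {p : Fin N → ℝ}, p ∈ selectionBox ε 0 ∅ → ∀ i, p i ∈ Set.Icc ε 1 :=
    fun hp => mem_Icc_of_mem_selectionBox le_rfl hp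
  have hNε : 0 < ε / N := div_pos hε (Nat.cast_pos.2 hN)
  refine hchain.tendsto_tv_of_mixture (w := fun p i => p i / ∑ j, p j)
    (G := fun i => gibbsStep i (κ i)) hV hS hπS hG (isCompact_selectionBox ε 0 ∅) ?_ ?_ ?_ hL
    hNε ?_ hX₀ (h₀ := 0) ?_ ha
  · exact fun i => ContinuousOn.div (by fun_prop) (by fun_prop) fun p hp =>
      (sum_pos_of_le hN hε fun j => (hD hp j).1).ne'
  · exact fun p hp i => div_nonneg (hε.le.trans (hD hp i).1)
      (sum_pos_of_le hN hε fun j => (hD hp j).1).le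
  · intro p hp
    rw [← Finset.sum_div, div_self (sum_pos_of_le hN hε fun j => (hD hp j).1).ne']
  · refine fun p' hp' x A _ => mixture_minorization hNε.le (fun i => ?_) _ x A
    exact (mul_le_of_le_one_right hNε.le (div_sum_le_one hN hε (fun j => (hp j).1) i)).trans
      (le_div_sum hN hε (hD hp') i)
  · intro h _
    filter_upwards [hq h] with ω hω
    exact mem_selectionBox.2 ⟨fun i => (hω i).1, fun i => by simpa using (hω i).2⟩

/-- Convergence of the adaptive multiple random scan, when the coordinates in `B` are bounded away
from one and the uniformly ergodic kernel `L` is dominated by every mixture of scans that gives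
weight to all nonempty sets of coordinates with complement in `B`. -/
theorem tendsto_tv_adaptive_mrsg (hN : 0 < N) (hS : MeasurableSet S) (hπS : π Sᶜ = 0)
    (hG : ∀ i, Compatible S π (gibbsStep i (κ i))) (hε : 0 < ε)
    (hX₀ : ∀ᵐ ω ∂P, X 0 ω ∈ S) (hq : ∀ h, ∀ᵐ ω ∂P, ∀ i, q h ω i ∈ Set.Icc ε 1)
    (ha : TendstoInMeasure P (fun h ω => q (h + 1) ω - q h ω) atTop (fun _ => 0))
    {B : Finset (Fin N)}
    (hB : ∀ i ∈ B, ∃ δ > 0, ∃ h₀, ∀ h ≥ h₀, ∀ᵐ ω ∂P, q h ω i ≤ 1 - δ)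
    {L : Kernel (∀ i, E i) (∀ i, E i)} (hL : UniformlyErgodicOn S L π)
    (hmin : ∀ (w : Finset (Fin N) → ℝ) (m : ℝ), 0 ≤ m → (∀ T, 0 ≤ w T) →
      (∀ T : Finset (Fin N), T.Nonempty → (∀ i ∉ T, i ∈ B) → m ≤ w T) →
      ∀ x A, ENNReal.ofReal m * L x A ≤ mixture w (fun T => scan κ (T.sort (· ≤ ·))) x A)
    (hchain : IsAdaptiveChain P ℱ (mrsg κ) X q) :
    Tendsto (fun h => tv (P.map (X h)) π) atTop (𝓝 0) := by
  obtain ⟨δ, hδ, h₀, hδB⟩ : ∃ δ > 0, ∃ h₀, ∀ i ∈ B, ∀ h ≥ h₀, ∀ᵐ ω ∂P, q h ω i ≤ 1 - δ := by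
    clear hmin
    induction B using Finset.induction_on with
    | empty => exact ⟨1, one_pos, 0, by simp⟩
    | insert i B _ ih =>
      obtain ⟨δ₁, hδ₁, h₁, h⟩ := ih fun j hj => hB j (Finset.mem_insert_of_mem hj)
      obtain ⟨δ₂, hδ₂, h₂, h'⟩ := hB i (Finset.mem_insert_self i B)
      refine ⟨min δ₁ δ₂, lt_min hδ₁ hδ₂, max h₁ h₂, fun j hj k hk => ?_⟩
      rcases Finset.mem_insert.1 hj with rfl | hj
      · filter_upwards [h' k ((le_max_right _ _).trans hk)] with ω hω
        linarith [min_le_right δ₁ δ₂]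
      · filter_upwards [h j hj k ((le_max_left _ _).trans hk)] with ω hω
        linarith [min_le_left δ₁ δ₂]
  have hD : ∀ {p : Fin N → ℝ}, p ∈ selectionBox ε δ B → ∀ i, p i ∈ Set.Icc ε 1 :=
    fun hp => mem_Icc_of_mem_selectionBox hδ.le hp
  have hm : 0 < min ε δ ^ N := pow_pos (lt_min hε hδ) N
  refine IsAdaptiveChain.tendsto_tv_of_mixture (w := selectProb)
    (G := fun T => scan κ (T.sort (· ≤ ·))) (V := 1) le_rfl (r := q) (ℱ := ℱ) ?_ hS hπS
    (fun T => compatible_scan hS hG _) (isCompact_selectionBox ε δ B)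
    (continuousOn_selectProb hN hε hδ.le B) (fun p hp => selectProb_nonneg hN hε (hD hp))
    (fun p hp => sum_selectProb hN hε (hD hp)) hL hm ?_ hX₀ (h₀ := h₀) ?_ ha
  · simp_rw [pow_one]
    exact hchain
  · exact fun p hp x A _ => hmin _ _ hm.le (selectProb_nonneg hN hε (hD hp))
      (fun T hT hTB => le_selectProb hN hε hδ hp hT hTB) x A
  · intro h hh
    have hall : ∀ᵐ ω ∂P, ∀ i ∈ B, q h ω i ≤ 1 - δ :=
      (Finset.eventually_all B).2 fun i hi => hδB i hi h hh
    filter_upwards [hq h, hall] with ω h1 h2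
    refine mem_selectionBox.2 ⟨fun i => (h1 i).1, fun i => ?_⟩
    split_ifs with hi
    exacts [h2 i hi, (h1 i).2]

end Samplers

theorem tv_eq_zero_of_subsingleton {α : Type*} [MeasurableSpace α] [Subsingleton α]
    (μ ν : Measure α) [IsProbabilityMeasure μ] [IsProbabilityMeasure ν] : tv μ ν = 0 := by
  refine le_antisymm (iSup₂_le fun A _ => ?_) zero_le
  rcases A.eq_empty_or_nonempty with rfl | h
  · simp
  · simp [Subsingleton.eq_univ_of_nonempty h]

end RandomScan

theorem proposition2 {N : ℕ} {E : Fin N → Type*} [∀ i, MeasurableSpace (E i)]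
    -- the state space and the target distribution with its full conditionals
    (S : Set (∀ i, E i)) (hS : MeasurableSet S)
    (π : Measure (∀ i, E i)) [IsProbabilityMeasure π] (hπS : π Sᶜ = 0)
    (κ : ∀ i : Fin N, Kernel (∀ j : {j : Fin N // j ≠ i}, E j.1) (E i))
    [∀ i, IsMarkovKernel (κ i)]
    (hκ : ∀ i, RandomScan.IsFullConditional π i (κ i))
    (hκS : ∀ i, ∀ x ∈ S, RandomScan.gibbsStep i (κ i) x Sᶜ = 0)
    -- the adaptive run with its starting values
    {Ω : Type*} {mΩ : MeasurableSpace Ω} (P : Measure Ω) [IsProbabilityMeasure P]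
    (ℱ : Filtration ℕ mΩ) (X : ℕ → Ω → ∀ i, E i) (q : ℕ → Ω → Fin N → ℝ)
    (ε : ℝ) (hε : 0 < ε)
    (x₀ : ∀ i, E i) (hx₀ : x₀ ∈ S) (hX₀ : ∀ᵐ ω ∂P, X 0 ω = x₀)
    (q₀ : Fin N → ℝ) (hq₀ : ∀ᵐ ω ∂P, q 0 ω = q₀)
    (hq : ∀ h, ∀ᵐ ω ∂P, ∀ i, q h ω i ∈ Set.Icc ε 1)
    -- diminishing adaptation
    (ha : TendstoInMeasure P (fun h ω => q (h + 1) ω - q h ω) atTop (fun _ => 0)) :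
    -- the adaptive single-site sampler, with `V` sub-iterations in each iteration
    (∀ V : ℕ, 1 ≤ V →
      (∃ p : Fin N → ℝ, (∀ i, p i ∈ Set.Icc ε 1) ∧
        RandomScan.UniformlyErgodicOn S (RandomScan.rsg κ p) π) →
      RandomScan.IsAdaptiveChain P ℱ (fun p => RandomScan.rsg κ p ^ V) X (fun h => q (h + 1)) →
      Tendsto (fun h => RandomScan.tv (P.map (X h)) π) atTop (𝓝 0)) ∧
    -- the adaptive multiple random-scan sampler
    ((∃ p : Fin N → ℝ, (∀ i, p i ∈ Set.Icc ε 1) ∧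
        ((RandomScan.UniformlyErgodicOn S (RandomScan.mrsg κ p) π ∧
            ∀ i, p i = 1 ∨ ∃ δ > 0, ∃ h₀, ∀ h ≥ h₀, ∀ᵐ ω ∂P, q h ω i ≤ 1 - δ) ∨
          (RandomScan.UniformlyErgodicOn S (RandomScan.rsg κ p) π ∧
            ∀ i, ∃ δ > 0, ∃ h₀, ∀ h ≥ h₀, ∀ᵐ ω ∂P, q h ω i ≤ 1 - δ))) →
      RandomScan.IsAdaptiveChain P ℱ (RandomScan.mrsg κ) X q →
      Tendsto (fun h => RandomScan.tv (P.map (X h)) π) atTop (𝓝 0)) := by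
  have hXS₀ : ∀ᵐ ω ∂P, X 0 ω ∈ S := hX₀.mono fun ω hω => hω ▸ hx₀
  have hG : ∀ i, RandomScan.Compatible S π (RandomScan.gibbsStep i (κ i)) :=
    fun i => RandomScan.compatible_gibbsStep (hκ i) (hκS i)
  rcases Nat.eq_zero_or_pos N with rfl | hN
  · -- without coordinates the state space is a single point
    have hzero : (∀ h, Measurable (X h)) →
        Tendsto (fun h => RandomScan.tv (P.map (X h)) π) atTop (𝓝 0) := fun hX => by
      have := fun h => Measure.isProbabilityMeasure_map (μ := P) (hX h).aemeasurable
      simp [RandomScan.tv_eq_zero_of_subsingleton]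
    exact ⟨fun V _ _ hc => hzero fun h => (hc.measurable_state h).mono (ℱ.le h) le_rfl,
      fun _ hc => hzero fun h => (hc.measurable_state h).mono (ℱ.le h) le_rfl⟩
  refine ⟨fun V hV ⟨p, hp, hL⟩ hchain => ?_, ?_⟩
  · exact RandomScan.tendsto_tv_adaptive_rsg hN hS hπS hG hε hXS₀ (fun h => hq (h + 1))
      (fun δ hδ => (ha δ hδ).comp (tendsto_add_atTop_nat 1)) hV hp hL hchain
  · rintro ⟨p, hp, ⟨hL, hB⟩ | ⟨hL, hB⟩⟩ hchain
    · refine RandomScan.tendsto_tv_adaptive_mrsg hN hS hπS hG hε hXS₀ hq ha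
        (B := Finset.univ.filter fun i => p i ≠ 1)
        (fun i hi => (hB i).resolve_left (Finset.mem_filter.1 hi).2) hL ?_ hchain
      refine fun w m hm hw h x A => RandomScan.mixture_minorization hm (fun T => ?_) _ x A
      by_cases hT : ¬T.Nonempty ∨ ∃ i ∉ T, p i = 1
      · rw [RandomScan.selectProb_eq_zero hT, mul_zero]
        exact hw T
      · push Not at hT
        exact (mul_le_of_le_one_right hm (RandomScan.selectProb_le_one hN hε hp T)).trans
          (h T hT.1 fun i hi => Finset.mem_filter.2 ⟨Finset.mem_univ i, hT.2 i hi⟩)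
    · exact RandomScan.tendsto_tv_adaptive_mrsg hN hS hπS hG hε hXS₀ hq ha (B := Finset.univ)
        (fun i _ => hB i) hL
        (fun w m _ _ h x A => RandomScan.rsg_minorization
          (RandomScan.div_sum_le_one hN hε fun i => (hp i).1)
          (fun i => h {i} (Finset.singleton_nonempty i) fun j _ => Finset.mem_univ j) x A) hchain
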